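/- **Setting.** Let $G$ be an undirected loopless weighted graph on $N$ items with symmetric edge weights in $[0,w_{\max}]$, $0<w_{\max}\le 1$ (an edge is a pair of nonzero weight); this is the private input. Two such graphs are *edge-neighbouring* if they differ in at most one edge (added, removed, or changed in weight). A randomized mechanism $M$ is $(\varepsilon,\delta)$-*edge differentially private* if $\Pr[M(G)\in S]\le e^{\varepsilon}\Pr[M(G')\in S]+\delta$ for all edge-neighbouring $G,G'$ and all measurable $S$. The items carry public feature vectors $x_1,\dots,x_N\in\mathbb R^d$. **Graph synthesis.** (i) *Clipping.* Every node $i$ selects its top-$D_{\max}$ neighbours in $G$ by cosine similarity of the features (ties broken by index); the clipped graph $A=A(G)$ keeps the edge $\{i,j\}$, with its weight, if and only if $i$ and $j$ select each other. (ii) *Motif loss.* For a pair $\{i,j\}$ let $M_{ij}(A)=\sum_k A_{ij}A_{ik}A_{jk}$ be its weighted triangle count. For weights $W=(W_e)$ on the unordered pairs $e$ of distinct items let $$\mathcal L_A(W)=\tfrac12\sum_e (W_e-M_e(A))^2+\lambda\sum_e (W_e-A_e)^2+\tau\sum_e W_e\log W_e,\qquad \lambda,\tau\ge 0 .$$ (iii)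 *Noisy mirror descent.* Starting from a fixed public $W^{(0)}$ with positive entries, for $t=0,\dots,T-1$, $$W^{(t+1)}=\arg\min_{W\ge 0}\Big(\langle\nabla\mathcal L_A(W^{(t)})+Z_t,W\rangle+\tfrac1\eta D_{KL}(W\|W^{(t)})\Big),$$ where $\eta>0$, $D_{KL}(W\|V)=\sum_e (W_e\log\frac{W_e}{V_e}-W_e+V_e)$, and the $Z_t\sim\mathcal N(0,\sigma^2 I)$ are independent. (iv) *Release.* With $W'$ the symmetric zero-diagonal matrix of $W^{(T)}$, release only $\hat W_{ij}=\log(1+\max(0,W'_{ij}))/\max_{u,v}\log(1+\max(0,W'_{uv}))$ (with $0/0=0$). **Theorem 1 (Privacy Guarantee).** For every $\lambda\ge0$ there is a constant $C>0$, depending only on $\lambda$, such that, with $\Delta_2=C\,D_{\max}\,w_{\max}$: 1. (Sensitivity.) For all edge-neighbouring $G,G'$ and all $W$ with positive entries, $\|\nabla\mathcal L_{A(G)}(W)-\nabla\mathcal L_{A(G')}(W)\|_2\le\Delta_2$, independently of $N$. 2. (Privacy.) For every $K>0$ there is a constant $c>0$, depending only on $\lambda$ and $K$, such that for all $\varepsilon>0$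 and $\delta\in(0,1)$ with $\varepsilon\le K\ln(1/\delta)$ and every noise scale $$\sigma\ \ge\ c\,\frac{\Delta_2\sqrt{T\ln(1/\delta)}}{\varepsilon},$$ the graph synthesis $G\mapsto\hat W$ satisfies $(\varepsilon,\delta)$-edge differential privacy, for all $N,d,D_{\max},T$, features, $w_{\max}$, $\tau$, $\eta$ and $W^{(0)}$. 3. (Distillation.) Under the same conditions, every randomized procedure applied to $\hat W$ that uses no other private data (only $\hat W$, public data and its own independent randomness), in particular the dual-stream hashing training, has $(\varepsilon,\delta)$-edge differentially private output. -/

import Mathlib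

open MeasureTheory ProbabilityTheory
open scoped ENNReal NNReal

noncomputable section

namespace MotifDP

/-! ### The private input: weighted interaction graphs and edge adjacency -/

/-- A weighted undirected loopless graph on `N` items with edge weights in `[0, wmax]`;
a pair of items is an edge when its weight is nonzero. -/
structure InteractionGraph (N : ℕ) (wmax : ℝ) where
  weight : Fin N → Fin N → ℝ
  symm : ∀ i j, weight i j = weight j i
  loopless : ∀ i, weight i i = 0
  nonneg : ∀ i j, 0 ≤ weight i j
  le_max : ∀ i j, weight i j ≤ wmax

/-- Two graphs are edge-neighbouring when they differ in at most one edge, which may be added,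
removed, or have its weight modified. -/
def EdgeNeighbor {N : ℕ} {wmax : ℝ} (G G' : InteractionGraph N wmax) : Prop :=
  ∃ a b : Fin N, ∀ i j : Fin N, s(i, j) ≠ s(a, b) → G.weight i j = G'.weight i j

/-- `(ε, δ)`-edge differential privacy of a randomized mechanism, given by the law `M G` of its
output on every input graph `G`. -/
def IsEdgeDP {N : ℕ} {wmax : ℝ} {Ω : Type*} [MeasurableSpace Ω]
    (M : InteractionGraph N wmax → Measure Ω) (ε δ : ℝ) : Prop :=
  (∀ G, IsProbabilityMeasure (M G)) ∧
    ∀ G G', EdgeNeighbor G G' → ∀ S : Set Ω, MeasurableSet S →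
      M G S ≤ ENNReal.ofReal (Real.exp ε) * M G' S + ENNReal.ofReal δ

/-! ### Degree clipping -/

/-- Cosine similarity of the (public) features of items `i` and `j`. -/
def cosSim {N d : ℕ} (x : Fin N → EuclideanSpace ℝ (Fin d)) (i j : Fin N) : ℝ :=
  inner ℝ (x i) (x j) / (‖x i‖ * ‖x j‖)

/-- `k` is ranked strictly before `j` by node `i`: larger cosine similarity to `i`, ties broken
by index. -/
def Precedes {N d : ℕ} (x : Fin N → EuclideanSpace ℝ (Fin d)) (i k j : Fin N) : Prop :=
  cosSim x i j < cosSim x i k ∨ (cosSim x i j = cosSim x i k ∧ k < j)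

open Classical in
/-- The top-`D` neighbours of node `i` in `G` under cosine similarity. -/
def topNeighbors {N d : ℕ} {wmax : ℝ} (x : Fin N → EuclideanSpace ℝ (Fin d)) (D : ℕ)
    (G : InteractionGraph N wmax) (i : Fin N) : Finset (Fin N) :=
  Finset.univ.filter fun j => G.weight i j ≠ 0 ∧
    (Finset.univ.filter fun k => G.weight i k ≠ 0 ∧ Precedes x i k j).card < D

open Classical in
/-- The degree-clipped graph: an edge is kept when each endpoint is among the top-`D` neighbours
of the other one. -/
def clip {N d : ℕ} {wmax : ℝ} (x : Fin N → EuclideanSpace ℝ (Fin d)) (D : ℕ)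
    (G : InteractionGraph N wmax) : InteractionGraph N wmax where
  weight i j := if j ∈ topNeighbors x D G i ∧ i ∈ topNeighbors x D G j then G.weight i j else 0
  symm i j := by
    simp only [and_comm, G.symm i j]
  loopless i := by simp [G.loopless i]
  nonneg i j := by
    split_ifs
    · exact G.nonneg i j
    · exact le_rfl
  le_max i j := by
    split_ifs
    · exact G.le_max i j
    · exact (G.nonneg i j).trans (G.le_max i j)

/-! ### Motif loss -/

/-- The unordered pairs of distinct items, each listed with its smaller element first. -/
abbrev Pair (N : ℕ) : Type := {p : Fin N × Fin N // p.1 < p.2}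

/-- Synthetic edge weights, one for every unordered pair of items. -/
abbrev Weights (N : ℕ) : Type := Pair N → ℝ

/-- The weighted triangle count at the pair `p`: the sum, over the third vertex, of the product
of the three edge weights of the triangle. -/
def triangleCount {N : ℕ} {wmax : ℝ} (A : InteractionGraph N wmax) (p : Pair N) : ℝ :=
  ∑ k, A.weight p.1.1 p.1.2 * A.weight p.1.1 k * A.weight p.1.2 k

/-- The motif-preservation loss: squared distance of the synthetic weights to the triangle counts
of the graph `A`, a quadratic regularizer centred at the edge weights of `A`, and a negative
entropy regularizer. -/
def motifLoss {N : ℕ} {wmax : ℝ} (lam tau : ℝ) (A : InteractionGraph N wmax) (W : Weights N) : ℝ :=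
  (1 / 2) * ∑ p, (W p - triangleCount A p) ^ 2
    + lam * ∑ p : Pair N, (W p - A.weight p.1.1 p.1.2) ^ 2
    + tau * ∑ p, W p * Real.log (W p)

/-- The gradient of the motif loss at a positive weight vector (see `hasFDerivAt_motifLoss`). -/
def motifGrad {N : ℕ} {wmax : ℝ} (lam tau : ℝ) (A : InteractionGraph N wmax) (W : Weights N) :
    Weights N := fun p =>
  (W p - triangleCount A p) + lam * (2 * (W p - A.weight p.1.1 p.1.2))
    + tau * (Real.log (W p) + 1)

theorem hasFDerivAt_motifLoss {N : ℕ} {wmax : ℝ} (lam tau : ℝ) (A : InteractionGraph N wmax)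
    (W : Weights N) (hW : ∀ p, 0 < W p) :
    HasFDerivAt (motifLoss lam tau A)
      (∑ p, motifGrad lam tau A W p • ContinuousLinearMap.proj (R := ℝ) (φ := fun _ : Pair N => ℝ) p)
      W := by
  have hp : ∀ p : Pair N, HasFDerivAt (fun V : Weights N => V p)
      (ContinuousLinearMap.proj (R := ℝ) (φ := fun _ : Pair N => ℝ) p) W :=
    fun p => hasFDerivAt_apply p W
  have h1 := (HasFDerivAt.fun_sum (u := Finset.univ) fun p _ =>
    ((hp p).sub_const (triangleCount A p)).pow 2).const_mul (1 / 2)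
  have h2 := (HasFDerivAt.fun_sum (u := Finset.univ) fun p _ =>
    ((hp p).sub_const (A.weight p.1.1 p.1.2)).pow 2).const_mul lam
  have h3 := (HasFDerivAt.fun_sum (u := Finset.univ) fun p _ =>
    (Real.hasDerivAt_mul_log (hW p).ne').comp_hasFDerivAt W (hp p)).const_mul tau
  refine ((h1.add h2).add h3).congr_fderiv ?_
  ext V
  simp [motifGrad, Finset.mul_sum, ← Finset.sum_add_distrib]
  refine Finset.sum_congr rfl fun p _ => ?_
  ring

/-! ### Noisy mirror descent -/

/-- The (generalized) Kullback–Leibler divergence of nonnegative weights `W` from positive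
weights `V`, i.e. the Bregman divergence of the negative entropy. -/
def klDivergence {N : ℕ} (W V : Weights N) : ℝ :=
  ∑ p, (W p * Real.log (W p / V p) - W p + V p)

/-- The objective `⟨g, W⟩ + D_KL(W ‖ V) / η` of a mirror descent step. -/
def mirrorObjective {N : ℕ} (η : ℝ) (V g W : Weights N) : ℝ :=
  ∑ p, g p * W p + 1 / η * klDivergence W V

/-- The mirror descent step from positive weights `V` with gradient `g`: the unique minimizer of
`mirrorObjective η V g` over nonnegative weights (see `mirrorStep_spec`). -/
def mirrorStep {N : ℕ} (η : ℝ) (V g : Weights N) : Weights N :=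
  fun p => V p * Real.exp (-η * g p)

theorem mirrorStep_spec {N : ℕ} {η : ℝ} (hη : 0 < η) (V g : Weights N) (hV : ∀ p, 0 < V p) :
    (∀ p, 0 < mirrorStep η V g p) ∧
      ∀ W : Weights N, (∀ p, 0 ≤ W p) → W ≠ mirrorStep η V g →
        mirrorObjective η V g (mirrorStep η V g) < mirrorObjective η V g W := by
  have hpos : ∀ p, 0 < mirrorStep η V g p := fun p => mul_pos (hV p) (Real.exp_pos _)
  refine ⟨hpos, fun W hW hne => ?_⟩
  have key : ∀ X : Weights N, (∀ p, 0 ≤ X p) → mirrorObjective η V g X =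
      ∑ p, 1 / η * (mirrorStep η V g p * InformationTheory.klFun (X p / mirrorStep η V g p)
        + (V p - mirrorStep η V g p)) := by
    intro X hX
    rw [mirrorObjective, klDivergence, Finset.mul_sum, ← Finset.sum_add_distrib]
    refine Finset.sum_congr rfl fun p _ => ?_
    have hu := hpos p
    rcases (hX p).eq_or_lt with h0 | h0
    · simp [← h0, InformationTheory.klFun_apply]
    · have hlog : Real.log (X p / mirrorStep η V g p) = Real.log (X p / V p) + η * g p := by
        rw [Real.log_div h0.ne' hu.ne', Real.log_div h0.ne' (hV p).ne', mirrorStep,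
          Real.log_mul (hV p).ne' (Real.exp_pos _).ne', Real.log_exp]
        ring
      rw [InformationTheory.klFun_apply, hlog]
      field_simp
      ring
  rw [key _ (fun p => (hpos p).le), key W hW]
  obtain ⟨q, hq⟩ := Function.ne_iff.mp hne
  have hself : ∀ p, InformationTheory.klFun (mirrorStep η V g p / mirrorStep η V g p) = 0 :=
    fun p => by rw [div_self (hpos p).ne', InformationTheory.klFun_one]
  have hnn : ∀ p, 0 ≤ InformationTheory.klFun (W p / mirrorStep η V g p) :=
    fun p => InformationTheory.klFun_nonneg (div_nonneg (hW p) (hpos p).le)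
  refine Finset.sum_lt_sum (fun p _ => ?_) ⟨q, Finset.mem_univ q, ?_⟩
  · rw [hself p]
    have := mul_nonneg (hpos p).le (hnn p)
    exact mul_le_mul_of_nonneg_left (by linarith) (by positivity)
  · rw [hself q]
    have h1 : InformationTheory.klFun (W q / mirrorStep η V g q) ≠ 0 := by
      rw [Ne, InformationTheory.klFun_eq_zero_iff (div_nonneg (hW q) (hpos q).le),
        div_eq_one_iff_eq (hpos q).ne']
      exact hq
    have := mul_pos (hpos q) (lt_of_le_of_ne (hnn q) h1.symm)
    exact mul_lt_mul_of_pos_left (by linarith) (by positivity)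

/-- The law `N(0, σ² I)` of the gradient noise. -/
def gaussianNoise (N : ℕ) (σ : ℝ≥0) : Measure (Weights N) :=
  Measure.pi fun _ => gaussianReal 0 (σ ^ 2)

/-- The law of the iterate `W⁽ᵗ⁾` of noisy mirror descent for the motif loss of the graph `A`,
started at `W₀`, with fresh independent noise in every step. -/
def noisyMirrorDescent {N : ℕ} {wmax : ℝ} (lam tau η : ℝ) (σ : ℝ≥0) (W₀ : Weights N)
    (A : InteractionGraph N wmax) : ℕ → Measure (Weights N)
  | 0 => Measure.dirac W₀
  | t + 1 => (noisyMirrorDescent lam tau η σ W₀ A t).bind fun W =>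
      (gaussianNoise N σ).map fun Z => mirrorStep η W (motifGrad lam tau A W + Z)

/-! ### Release of the synthetic graph -/

/-- The symmetric weighted adjacency matrix, with zero diagonal, of synthetic edge weights. -/
def toMatrix {N : ℕ} (W : Weights N) (i j : Fin N) : ℝ :=
  if h : i < j then W ⟨(i, j), h⟩ else if h : j < i then W ⟨(j, i), h⟩ else 0

/-- Rectified log-normalization. -/
def logNorm {N : ℕ} (W : Fin N → Fin N → ℝ) (i j : Fin N) : ℝ :=
  Real.log (1 + max 0 (W i j)) / ⨆ uv : Fin N × Fin N, Real.log (1 + max 0 (W uv.1 uv.2))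

/-- The graph-synthesis mechanism: clip the input graph, run `T` steps of noisy mirror descent on
the motif loss of the clipped graph, and release the rectified log-normalized last iterate. -/
def graphSynthesis {N d : ℕ} {wmax : ℝ} (x : Fin N → EuclideanSpace ℝ (Fin d)) (D : ℕ)
    (lam tau η : ℝ) (σ : ℝ≥0) (W₀ : Weights N) (T : ℕ) (G : InteractionGraph N wmax) :
    Measure (Fin N → Fin N → ℝ) :=
  (noisyMirrorDescent lam tau η σ W₀ (clip x D G) T).map fun W => logNorm (toMatrix W)

end MotifDP

end

/-! Two independent facts combine: the gradient has small sensitivity on clipped graphs, and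
Gaussian noise turns sensitivity into privacy through a Rényi-type argument.

Sensitivity. Only the top lists of the endpoints `a`, `b` of the altered edge can change. Apart from
the altered endpoint itself, each list loses at most one node and gains at most one, because one
edge shifts ranks by at most one (`card_topNeighbors_sdiff_le`). Hence clipping has `L¹`-sensitivity
`O(wmax)`, whatever `N` and `D` are. A triangle product changes by telescoping; each term is one
edge difference times a weight and a factor at most `wmax`. Summing over the vertex not on the
differing edge gives a row sum of a clipped graph, at most `D * wmax`
(`sum_abs_triangleCount_sub_le`). The total is `O(D * wmax ^ 3)`, and `wmax ≤ 1` makes it `O(D *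
wmax)`. The terms in `W` and `tau` cancel in the difference of gradients.

Privacy. `HolderBound` states a Rényi bound as `∫ f dμ ≤ B ‖f‖_{L^q(ν)}`, so no densities of the
iterates are needed. In this form post-processing is a substitution, adaptive composition multiplies
the constants (`HolderBound.bind`), and products tensorize. One step is a fixed map of a Gaussian
shifted by the gradient, so `T` steps cost `exp ((p - 1) * R)` with `R = T * Δ ^ 2 / (2 * σ ^ 2)`.
Testing on indicators and applying Young's inequality gives `(ε, δ)`-privacy once `p` is chosen well
(`exists_holderConjugate`). -/

namespace MotifDP

/-! ### Hölder domination of measures -/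

/-- Hölder domination of `μ` by `ν` with exponent `q` and constant `B`. For the conjugate
exponent `p`, it is the variational form of the bound `B` on the `L^p(ν)`-norm of `dμ/dν`, that is
of a bound on the Rényi divergence of order `p`. -/
def HolderBound {X : Type*} [MeasurableSpace X] (q : ℝ) (B : ℝ≥0∞) (μ ν : Measure X) : Prop :=
  ∀ f : X → ℝ≥0∞, Measurable f → ∫⁻ x, f x ∂μ ≤ B * (∫⁻ x, f x ^ q ∂ν) ^ (1 / q)

namespace HolderBound

variable {X Y : Type*} [MeasurableSpace X] [MeasurableSpace Y] {q : ℝ} {B B' : ℝ≥0∞}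
  {μ ν : Measure X}

theorem mono (h : HolderBound q B μ ν) (hB : B ≤ B') : HolderBound q B' μ ν :=
  fun f hf => (h f hf).trans (by gcongr)

theorem refl {p : ℝ} (hpq : p.HolderConjugate q) (μ : Measure X) [IsProbabilityMeasure μ] :
    HolderBound q 1 μ μ := by
  intro f hf
  have := ENNReal.lintegral_mul_le_Lp_mul_Lq μ hpq (f := fun _ => 1) aemeasurable_const
    hf.aemeasurable
  simpa using this

theorem map (h : HolderBound q B μ ν) {g : X → Y} (hg : Measurable g) :
    HolderBound q B (μ.map g) (ν.map g) := by
  intro f hf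
  rw [lintegral_map hf hg, lintegral_map (hf.pow_const q) hg]
  exact h _ (hf.comp hg)

/-- Adaptive composition: the inner bound replaces `f` by its `L^q(κ' x)`-norm as a function of `x`,
and the outer bound applies to that function; the powers `1 / q` and `q` cancel. -/
theorem bind {κ κ' : X → Measure Y} (h : HolderBound q B μ ν) (hq : 0 < q) (hκ : Measurable κ)
    (hκ' : Measurable κ') (hb : ∀ x, HolderBound q B' (κ x) (κ' x)) :
    HolderBound q (B * B') (μ.bind κ) (ν.bind κ') := by
  intro f hf
  rw [Measure.lintegral_bind hκ.aemeasurable hf.aemeasurable,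
    Measure.lintegral_bind hκ'.aemeasurable (hf.pow_const q).aemeasurable]
  have hm : Measurable fun x => ∫⁻ y, f y ^ q ∂κ' x :=
    (Measure.measurable_lintegral (hf.pow_const q)).comp hκ'
  calc ∫⁻ x, ∫⁻ y, f y ∂κ x ∂μ
      ≤ ∫⁻ x, B' * (∫⁻ y, f y ^ q ∂κ' x) ^ (1 / q) ∂μ := lintegral_mono fun x => hb x f hf
    _ = B' * ∫⁻ x, (∫⁻ y, f y ^ q ∂κ' x) ^ (1 / q) ∂μ := lintegral_const_mul _ (hm.pow_const _)
    _ ≤ B' * (B * (∫⁻ x, ((∫⁻ y, f y ^ q ∂κ' x) ^ (1 / q)) ^ q ∂ν) ^ (1 / q)) := by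
        gcongr
        exact h _ (hm.pow_const _)
    _ = B * B' * (∫⁻ x, ∫⁻ y, f y ^ q ∂κ' x ∂ν) ^ (1 / q) := by
        simp_rw [← ENNReal.rpow_mul, one_div_mul_cancel hq.ne', ENNReal.rpow_one]
        ring

/-- Tensorization, integrating out one coordinate at a time with the remaining ones frozen; each
coordinate contributes its own factor as in `bind`. -/
theorem pi {ι : Type*} [Fintype ι] {E : ι → Type*} [∀ i, MeasurableSpace (E i)]
    {μ ν : ∀ i, Measure (E i)} [∀ i, IsProbabilityMeasure (μ i)] [∀ i, IsProbabilityMeasure (ν i)]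
    {b : ι → ℝ≥0∞} (hq : 0 < q) (h : ∀ i, HolderBound q (b i) (μ i) (ν i)) :
    HolderBound q (∏ i, b i) (Measure.pi μ) (Measure.pi ν) := by
  classical
  intro f hf
  have key : ∀ (s : Finset ι) (x : ∀ i, E i), (∫⋯∫⁻_s, f ∂μ) x ≤
      (∏ i ∈ s, b i) * ((∫⋯∫⁻_s, (fun y => f y ^ q) ∂ν) x) ^ (1 / q) := by
    intro s
    induction s using Finset.induction_on with
    | empty =>
      intro x
      simp [← ENNReal.rpow_mul, mul_inv_cancel₀ hq.ne']
    | insert i s hi ih =>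
      intro x
      have hm : Measurable fun y : E i =>
          (∫⋯∫⁻_s, (fun y => f y ^ q) ∂ν) (Function.update x i y) :=
        ((hf.pow_const q).lmarginal ν).comp (measurable_update x)
      rw [lmarginal_insert f hf hi, lmarginal_insert _ (hf.pow_const q) hi,
        Finset.prod_insert hi]
      calc ∫⁻ y, (∫⋯∫⁻_s, f ∂μ) (Function.update x i y) ∂μ i
          ≤ ∫⁻ y, (∏ i ∈ s, b i) *
              ((∫⋯∫⁻_s, (fun y => f y ^ q) ∂ν) (Function.update x i y)) ^ (1 / q) ∂μ i :=
            lintegral_mono fun y => ih _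
        _ = (∏ i ∈ s, b i) * ∫⁻ y,
              ((∫⋯∫⁻_s, (fun y => f y ^ q) ∂ν) (Function.update x i y)) ^ (1 / q) ∂μ i :=
            lintegral_const_mul _ (hm.pow_const _)
        _ ≤ (∏ i ∈ s, b i) * (b i * (∫⁻ y,
              (((∫⋯∫⁻_s, (fun y => f y ^ q) ∂ν) (Function.update x i y)) ^ (1 / q)) ^ q ∂ν i)
                ^ (1 / q)) := by
            gcongr
            exact h i _ (hm.pow_const _)
        _ = _ := by
            simp_rw [← ENNReal.rpow_mul, one_div_mul_cancel hq.ne', ENNReal.rpow_one]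
            ring
  obtain ⟨x⟩ : Nonempty (∀ i, E i) := nonempty_of_isProbabilityMeasure (Measure.pi μ)
  rw [lintegral_eq_lmarginal_univ x, lintegral_eq_lmarginal_univ x]
  exact key Finset.univ x

end HolderBound

/-! ### Gaussian shifts and conversion to approximate privacy -/

/-- Hölder's inequality applied to `f` times the likelihood ratio `exp L`; the constant is the
`L^p`-norm of that ratio, computed exactly. -/
theorem holderBound_gaussianReal {p q : ℝ} (hpq : p.HolderConjugate q) (m m' : ℝ) {v : ℝ≥0}
    (hv : v ≠ 0) :
    HolderBound q (ENNReal.ofReal (Real.exp ((p - 1) * (m - m') ^ 2 / (2 * v))))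
      (gaussianReal m v) (gaussianReal m' v) := by
  intro f hf
  have hv' : (v : ℝ) ≠ 0 := by exact_mod_cast hv
  set L : ℝ → ℝ := fun x => ((x - m') ^ 2 - (x - m) ^ 2) / (2 * v) with hL
  have hLm : Measurable fun x => ENNReal.ofReal (Real.exp (L x)) := by fun_prop
  have h1 : ∀ x, gaussianPDF m v x = gaussianPDF m' v x * ENNReal.ofReal (Real.exp (L x)) := by
    intro x
    rw [gaussianPDF_def, gaussianPDF_def, ← ENNReal.ofReal_mul (gaussianPDFReal_nonneg _ _ _)]
    simp only [gaussianPDFReal]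
    rw [mul_assoc (√(2 * Real.pi * v))⁻¹, ← Real.exp_add]
    congr 3
    simp only [hL]
    ring
  -- Completing the square: tilting by the `p`-th power of the ratio gives a multiple of another
  -- Gaussian density, with mean extrapolated beyond `m`.
  have h2 : ∀ x, gaussianPDF m' v x * ENNReal.ofReal (Real.exp (L x)) ^ p =
      ENNReal.ofReal (Real.exp (p * ((p - 1) * (m - m') ^ 2 / (2 * v)))) *
        gaussianPDF (p * m + (1 - p) * m') v x := by
    intro x
    rw [gaussianPDF_def, gaussianPDF_def, ENNReal.ofReal_rpow_of_pos (Real.exp_pos _),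
      ← ENNReal.ofReal_mul (gaussianPDFReal_nonneg _ _ _),
      ← ENNReal.ofReal_mul (Real.exp_pos _).le, ← Real.exp_mul]
    simp only [gaussianPDFReal]
    rw [mul_left_comm, mul_assoc (√(2 * Real.pi * v))⁻¹, ← Real.exp_add, ← Real.exp_add]
    congr 3
    simp only [hL]
    field_simp
    ring
  have h3 : ∫⁻ x, ENNReal.ofReal (Real.exp (L x)) ^ p ∂gaussianReal m' v =
      ENNReal.ofReal (Real.exp (p * ((p - 1) * (m - m') ^ 2 / (2 * v)))) := by
    rw [gaussianReal_of_var_ne_zero _ hv,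
      lintegral_withDensity_eq_lintegral_mul _ (measurable_gaussianPDF _ _) (hLm.pow_const p)]
    simp only [Pi.mul_apply, h2]
    rw [lintegral_const_mul _ (measurable_gaussianPDF _ _), lintegral_gaussianPDF_eq_one _ hv,
      mul_one]
  have h4 : ∫⁻ x, f x ∂gaussianReal m v =
      ∫⁻ x, ENNReal.ofReal (Real.exp (L x)) * f x ∂gaussianReal m' v := by
    rw [gaussianReal_of_var_ne_zero _ hv, gaussianReal_of_var_ne_zero _ hv,
      lintegral_withDensity_eq_lintegral_mul _ (measurable_gaussianPDF _ _) hf,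
      lintegral_withDensity_eq_lintegral_mul (g := fun x => ENNReal.ofReal (Real.exp (L x)) * f x) _
        (measurable_gaussianPDF _ _) (hLm.mul hf)]
    simp only [Pi.mul_apply, h1, mul_assoc]
  rw [h4]
  refine (ENNReal.lintegral_mul_le_Lp_mul_Lq _ hpq hLm.aemeasurable hf.aemeasurable).trans_eq ?_
  rw [h3, ENNReal.ofReal_rpow_of_pos (Real.exp_pos _), ← Real.exp_mul]
  rw [mul_one_div, mul_div_cancel_left₀ _ hpq.ne_zero]

theorem holderBound_pi_gaussianReal {ι : Type*} [Fintype ι] {p q : ℝ}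
    (hpq : p.HolderConjugate q) (m m' : ι → ℝ) {v : ℝ≥0} (hv : v ≠ 0) :
    HolderBound q (ENNReal.ofReal (Real.exp ((p - 1) * ‖WithLp.toLp 2 (m - m')‖ ^ 2 / (2 * v))))
      (Measure.pi fun i => gaussianReal (m i) v) (Measure.pi fun i => gaussianReal (m' i) v) := by
  have h := HolderBound.pi hpq.symm.pos fun i => holderBound_gaussianReal hpq (m i) (m' i) hv
  convert h using 1
  rw [← ENNReal.ofReal_prod_of_nonneg fun _ _ => (Real.exp_pos _).le, ← Real.exp_sum,
    EuclideanSpace.norm_sq_eq]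
  simp [Finset.mul_sum, Finset.sum_div]

/-- Hölder domination implies approximate differential privacy. -/
theorem HolderBound.le_exp_mul_add {X : Type*} [MeasurableSpace X] {μ ν : Measure X}
    {p q r ε δ : ℝ} (hpq : p.HolderConjugate q) (h : HolderBound q (ENNReal.ofReal (Real.exp r)) μ ν)
    (hδ : 0 < δ) (hr : p * r - (p - 1) * ε ≤ Real.log δ) {S : Set X} (hS : MeasurableSet S) :
    μ S ≤ ENNReal.ofReal (Real.exp ε) * ν S + ENNReal.ofReal δ := by
  have h1 := h (S.indicator 1) (measurable_one.indicator hS)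
  have h2 : ∀ x, S.indicator (1 : X → ℝ≥0∞) x ^ q = S.indicator 1 x := by
    intro x
    by_cases hx : x ∈ S <;> simp [hx, hpq.symm.pos]
  simp only [h2, lintegral_indicator_one hS] at h1
  have hp1 : (1 : ℝ≥0∞) ≤ ENNReal.ofReal p := by
    rw [ENNReal.one_le_ofReal]; exact hpq.lt.le
  have hq1 : (1 : ℝ≥0∞) ≤ ENNReal.ofReal q := by
    rw [ENNReal.one_le_ofReal]; exact hpq.symm.lt.le
  have hqp : p / q = p - 1 := hpq.div_conj_eq_sub_one
  calc μ S ≤ ENNReal.ofReal (Real.exp r) * ν S ^ (1 / q) := h1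
    -- The factor `exp ε` is inserted so that Young's inequality returns `exp ε * ν S` plus a
    -- remainder `exp (p * r - (p - 1) * ε)`, which is at most `δ`.
    _ = (ENNReal.ofReal (Real.exp ε) * ν S) ^ (1 / q) *
          ENNReal.ofReal (Real.exp (r - ε / q)) := by
        rw [ENNReal.mul_rpow_of_nonneg _ _ (by have := hpq.symm.pos; positivity),
          ENNReal.ofReal_rpow_of_pos (Real.exp_pos _), ← Real.exp_mul, mul_right_comm,
          ← ENNReal.ofReal_mul (Real.exp_pos _).le, ← Real.exp_add]
        congr 3
        ring
    _ ≤ ((ENNReal.ofReal (Real.exp ε) * ν S) ^ (1 / q)) ^ q / ENNReal.ofReal q +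
          ENNReal.ofReal (Real.exp (r - ε / q)) ^ p / ENNReal.ofReal p :=
        ENNReal.young_inequality _ _ hpq.symm
    _ ≤ ENNReal.ofReal (Real.exp ε) * ν S + ENNReal.ofReal δ := by
        rw [← ENNReal.rpow_mul, one_div_mul_cancel hpq.symm.ne_zero, ENNReal.rpow_one,
          ENNReal.ofReal_rpow_of_pos (Real.exp_pos _), ← Real.exp_mul]
        gcongr
        · exact ENNReal.div_le_of_le_mul (le_mul_of_one_le_right' hq1)
        · refine (ENNReal.div_le_of_le_mul (le_mul_of_one_le_right' hp1)).trans ?_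
          gcongr
          rw [← Real.le_log_iff_exp_le hδ]
          calc (r - ε / q) * p = p * r - p / q * ε := by ring
            _ ≤ _ := by rw [hqp]; exact hr

end MotifDP

namespace MotifDP

/-! ### Privacy loss of noisy mirror descent -/

section MirrorDescent

variable {N : ℕ} {wmax : ℝ} (lam tau η : ℝ)

theorem measurable_motifGrad (A : InteractionGraph N wmax) :
    Measurable (motifGrad lam tau A) := by
  unfold motifGrad
  fun_prop

theorem measurable_mirrorStep : Measurable fun x : Weights N × Weights N => mirrorStep η x.1 x.2 := by
  unfold mirrorStep
  fun_prop

theorem map_add_gaussianNoise (σ : ℝ≥0) (g : Weights N) :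
    (gaussianNoise N σ).map (fun Z => g + Z) =
      Measure.pi fun p => gaussianReal (g p) (σ ^ 2) := by
  have h := Measure.pi_map_pi (μ := fun _ : Pair N => gaussianReal 0 (σ ^ 2))
    (f := fun p z => g p + z) fun p => by fun_prop
  simp only [gaussianReal_map_const_add, zero_add] at h
  exact h

instance isProbabilityMeasure_gaussianNoise (σ : ℝ≥0) :
    IsProbabilityMeasure (gaussianNoise N σ) := by
  unfold gaussianNoise
  infer_instance

/-- The law of one step of noisy mirror descent from the weights `W`. -/
noncomputable def stepLaw (σ : ℝ≥0) (A : InteractionGraph N wmax) (W : Weights N) : Measure (Weights N) :=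
  (gaussianNoise N σ).map fun Z => mirrorStep η W (motifGrad lam tau A W + Z)

theorem measurable_stepLaw (σ : ℝ≥0) (A : InteractionGraph N wmax) :
    Measurable (stepLaw lam tau η σ A) := by
  have h : Measurable fun x : Weights N × Weights N =>
      mirrorStep η x.1 (motifGrad lam tau A x.1 + x.2) :=
    (measurable_mirrorStep η).comp (measurable_fst.prodMk
      (((measurable_motifGrad lam tau A).comp measurable_fst).add measurable_snd))
  have h2 : stepLaw lam tau η σ A = fun W => ((gaussianNoise N σ).map (Prod.mk W)).map
      fun x : Weights N × Weights N => mirrorStep η x.1 (motifGrad lam tau A x.1 + x.2) := by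
    funext W
    rw [Measure.map_map h measurable_prodMk_left]
    rfl
  rw [h2]
  exact (Measure.measurable_map _ h).comp Measurable.map_prodMk_left

theorem measurable_mirrorStep_right (W : Weights N) : Measurable (mirrorStep η W) :=
  (measurable_mirrorStep η).comp measurable_prodMk_left

instance isProbabilityMeasure_stepLaw (σ : ℝ≥0) (A : InteractionGraph N wmax) (W : Weights N) :
    IsProbabilityMeasure (stepLaw lam tau η σ A W) := by
  refine Measure.isProbabilityMeasure_map (Measurable.aemeasurable ?_)
  exact (measurable_mirrorStep_right η W).comp (measurable_id.const_add _)

theorem isProbabilityMeasure_noisyMirrorDescent (σ : ℝ≥0) (W₀ : Weights N)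
    (A : InteractionGraph N wmax) (t : ℕ) :
    IsProbabilityMeasure (noisyMirrorDescent lam tau η σ W₀ A t) := by
  induction t with
  | zero => exact Measure.dirac.isProbabilityMeasure
  | succ t ih =>
    let κ : Kernel (Weights N) (Weights N) := ⟨_, measurable_stepLaw lam tau η σ A⟩
    have : IsMarkovKernel κ := ⟨isProbabilityMeasure_stepLaw lam tau η σ A⟩
    exact inferInstanceAs (IsProbabilityMeasure (κ ∘ₘ noisyMirrorDescent lam tau η σ W₀ A t))

/-- From the same `W`, both laws are images under the same map `mirrorStep η W` of Gaussians centred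
at the two gradients, so only the gradient difference matters. -/
theorem holderBound_stepLaw {p q : ℝ} (hpq : p.HolderConjugate q) {σ : ℝ≥0} (hσ : σ ≠ 0)
    (A A' : InteractionGraph N wmax) (W : Weights N) {Δ : ℝ}
    (hΔ : ‖WithLp.toLp 2 (motifGrad lam tau A W - motifGrad lam tau A' W)‖ ≤ Δ) :
    HolderBound q (ENNReal.ofReal (Real.exp ((p - 1) * Δ ^ 2 / (2 * σ ^ 2))))
      (stepLaw lam tau η σ A W) (stepLaw lam tau η σ A' W) := by
  have key : ∀ A : InteractionGraph N wmax, stepLaw lam tau η σ A W =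
      (Measure.pi fun p => gaussianReal (motifGrad lam tau A W p) (σ ^ 2)).map
        (mirrorStep η W) := by
    intro A
    rw [← map_add_gaussianNoise, Measure.map_map (measurable_mirrorStep_right η W) (by fun_prop)]
    rfl
  rw [key, key]
  refine ((holderBound_pi_gaussianReal hpq _ _ (pow_ne_zero 2 hσ)).map
    (measurable_mirrorStep_right η W)).mono ?_
  have := hpq.sub_one_pos
  gcongr
  simp

theorem holderBound_noisyMirrorDescent {p q : ℝ} (hpq : p.HolderConjugate q) {σ : ℝ≥0}
    (hσ : σ ≠ 0) (W₀ : Weights N) (A A' : InteractionGraph N wmax) {Δ : ℝ}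
    (hΔ : ∀ W, ‖WithLp.toLp 2 (motifGrad lam tau A W - motifGrad lam tau A' W)‖ ≤ Δ) (t : ℕ) :
    HolderBound q (ENNReal.ofReal (Real.exp (t * ((p - 1) * Δ ^ 2 / (2 * σ ^ 2)))))
      (noisyMirrorDescent lam tau η σ W₀ A t) (noisyMirrorDescent lam tau η σ W₀ A' t) := by
  induction t with
  | zero => simpa [noisyMirrorDescent] using HolderBound.refl hpq (Measure.dirac W₀)
  | succ t ih =>
    have h := ih.bind hpq.symm.pos (measurable_stepLaw lam tau η σ A)
      (measurable_stepLaw lam tau η σ A')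
      fun W => holderBound_stepLaw lam tau η hpq hσ A A' W (hΔ W)
    rw [← ENNReal.ofReal_mul (Real.exp_pos _).le, ← Real.exp_add] at h
    push_cast
    rw [add_one_mul]
    exact h

/-- Serves the case of zero sensitivity, where the noise may vanish and no Gaussian bound is
available. -/
theorem noisyMirrorDescent_congr (σ : ℝ≥0) (W₀ : Weights N) {A A' : InteractionGraph N wmax}
    (h : motifGrad lam tau A = motifGrad lam tau A') (t : ℕ) :
    noisyMirrorDescent lam tau η σ W₀ A t = noisyMirrorDescent lam tau η σ W₀ A' t := by
  induction t with
  | zero => rfl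
  | succ t ih => simp only [noisyMirrorDescent, ih, h]

end MirrorDescent

theorem measurable_logNorm_toMatrix (N : ℕ) :
    Measurable fun W : Weights N => logNorm (toMatrix W) := by
  have h : ∀ i j, Measurable fun W : Weights N => toMatrix W i j := by
    intro i j
    unfold toMatrix
    split_ifs <;> fun_prop
  have h2 : ∀ i j, Measurable fun W : Weights N => Real.log (1 + max 0 (toMatrix W i j)) := by
    intro i j
    have := h i j
    fun_prop
  refine measurable_pi_lambda _ fun i => measurable_pi_lambda _ fun j => ?_
  unfold logNorm
  exact (h2 i j).div (Measurable.iSup fun uv => h2 uv.1 uv.2)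

/-! ### Privacy of the release and of its post-processing -/

section Privacy

variable {N d : ℕ} {wmax : ℝ} (x : Fin N → EuclideanSpace ℝ (Fin d)) (D : ℕ) (lam tau η : ℝ)

theorem isProbabilityMeasure_graphSynthesis (σ : ℝ≥0) (W₀ : Weights N) (T : ℕ)
    (G : InteractionGraph N wmax) :
    IsProbabilityMeasure (graphSynthesis x D lam tau η σ W₀ T G) :=
  have := isProbabilityMeasure_noisyMirrorDescent lam tau η σ W₀ (clip x D G) T
  Measure.isProbabilityMeasure_map (measurable_logNorm_toMatrix N).aemeasurable

theorem isEdgeDP_of_forall_eq {Ω : Type*} [MeasurableSpace Ω]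
    {M : InteractionGraph N wmax → Measure Ω} {ε δ : ℝ} (hε : 0 ≤ ε)
    (hM : ∀ G, IsProbabilityMeasure (M G)) (h : ∀ G G', EdgeNeighbor G G' → M G = M G') :
    IsEdgeDP M ε δ := by
  refine ⟨hM, fun G G' hG S _ => ?_⟩
  rw [h G G' hG]
  refine le_add_right (le_mul_of_one_le_left' ?_)
  rw [ENNReal.one_le_ofReal]
  exact Real.one_le_exp hε

/-- The choice of the Rényi order that turns the total privacy loss `R` of all the steps into
`(ε, δ)`-privacy. -/
theorem exists_holderConjugate {K ε δ R : ℝ} (hε : 0 < ε) (hδ : 0 < δ)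
    (hδ1 : δ < 1) (hεK : ε ≤ K * Real.log (1 / δ))
    (hR : (K + 2) * (2 * R * Real.log (1 / δ)) ≤ ε ^ 2) :
    ∃ p q : ℝ, p.HolderConjugate q ∧ p * ((p - 1) * R) - (p - 1) * ε ≤ Real.log δ := by
  have hL : 0 < Real.log (1 / δ) := Real.log_pos (by rw [lt_div_iff₀ hδ]; linarith)
  have hlog : Real.log δ = -Real.log (1 / δ) := by simp
  set L := Real.log (1 / δ)
  have hs : 0 < 2 * L / ε := by positivity
  -- With `p - 1 = 2 * L / ε`, the exponent is `(p - 1) * (p * R - ε)`. It equals `-L = log δ` when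
  -- `p * R = ε / 2`, so `p * R ≤ ε / 2` suffices; `ε ≤ K * L` reduces this to `hR`.
  refine ⟨2 * L / ε + 1, _, Real.HolderConjugate.conjExponent (by linarith), ?_⟩
  have h1 : (2 * L / ε + 1) * R ≤ ε / 2 := by
    rcases le_or_gt R 0 with hR0 | hR0
    · have : (2 * L / ε + 1) * R ≤ 0 := mul_nonpos_of_nonneg_of_nonpos (by linarith) hR0
      linarith
    · have h2 : (2 * L + ε) * R ≤ ε / 2 * ε := by
        have : ε * R ≤ K * L * R := by gcongr
        nlinarith
      calc (2 * L / ε + 1) * R = (2 * L + ε) * R / ε := by field_simp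
        _ ≤ ε / 2 := by rw [div_le_iff₀ hε]; exact h2
  calc (2 * L / ε + 1) * ((2 * L / ε + 1 - 1) * R) - (2 * L / ε + 1 - 1) * ε
      = 2 * L / ε * ((2 * L / ε + 1) * R - ε) := by ring
    _ ≤ 2 * L / ε * (-(ε / 2)) := by gcongr; linarith
    _ = Real.log δ := by rw [hlog]; field_simp

/-- Privacy of the graph synthesis and of every post-processing of it, from a bound on the
`L²`-sensitivity of the gradient. -/
theorem isEdgeDP_graphSynthesis_bind {K ε δ Δ : ℝ} (hK : 0 < K) (hε : 0 < ε) (hδ : 0 < δ)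
    (hδ1 : δ < 1) (hεK : ε ≤ K * Real.log (1 / δ)) (σ : ℝ≥0) (T : ℕ) (hΔ0 : 0 ≤ Δ)
    (hσ : (K + 2) * Δ * √(T * Real.log (1 / δ)) / ε ≤ σ)
    (hΔ : ∀ G G' : InteractionGraph N wmax, EdgeNeighbor G G' → ∀ W : Weights N,
      ‖WithLp.toLp 2 (motifGrad lam tau (clip x D G) W - motifGrad lam tau (clip x D G') W)‖ ≤ Δ)
    (W₀ : Weights N) {Θ : Type*} [MeasurableSpace Θ] (train : Kernel (Fin N → Fin N → ℝ) Θ)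
    [IsMarkovKernel train] :
    IsEdgeDP (fun G : InteractionGraph N wmax =>
      (graphSynthesis x D lam tau η σ W₀ T G).bind train) ε δ := by
  have hL : 0 < Real.log (1 / δ) := Real.log_pos (by rw [lt_div_iff₀ hδ]; linarith)
  have hprob : ∀ G : InteractionGraph N wmax,
      IsProbabilityMeasure ((graphSynthesis x D lam tau η σ W₀ T G).bind train) := fun G =>
    have := isProbabilityMeasure_graphSynthesis x D lam tau η σ W₀ T G
    inferInstanceAs (IsProbabilityMeasure (train ∘ₘ graphSynthesis x D lam tau η σ W₀ T G))
  -- If `T = 0` or `Δ = 0`, the hypothesis on `σ` allows `σ = 0`; the output law is then the same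
  -- for neighbouring inputs. Otherwise `σ > 0`.
  rcases eq_or_ne T 0 with rfl | hT
  · exact isEdgeDP_of_forall_eq hε.le hprob fun G G' _ => rfl
  rcases hΔ0.eq_or_lt with h0 | h0
  · refine isEdgeDP_of_forall_eq hε.le hprob fun G G' hG => ?_
    have : motifGrad lam tau (clip x D G) = motifGrad lam tau (clip x D G') := by
      funext W
      have h := hΔ G G' hG W
      rw [← h0, norm_le_zero_iff, WithLp.toLp_eq_zero, sub_eq_zero] at h
      exact h
    simp only [graphSynthesis, noisyMirrorDescent_congr lam tau η σ W₀ this]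
  have hT' : (0 : ℝ) < T := by exact_mod_cast Nat.pos_of_ne_zero hT
  have hσ0 : 0 < (σ : ℝ) := lt_of_lt_of_le (by positivity) hσ
  obtain ⟨p, q, hpq, hp⟩ := exists_holderConjugate (R := T * (Δ ^ 2 / (2 * σ ^ 2)))
    hε hδ hδ1 hεK (by
      rw [div_le_iff₀ hε] at hσ
      have h1 : ((K + 2) * Δ * √(T * Real.log (1 / δ))) ^ 2 ≤ (σ * ε) ^ 2 := by gcongr
      rw [mul_pow, mul_pow, Real.sq_sqrt (by positivity), mul_pow] at h1
      have h2 : (K + 2) * Δ ^ 2 * (T * Real.log (1 / δ)) ≤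
          (K + 2) ^ 2 * Δ ^ 2 * (T * Real.log (1 / δ)) := by
        gcongr
        nlinarith
      calc (K + 2) * (2 * (T * (Δ ^ 2 / (2 * σ ^ 2))) * Real.log (1 / δ))
          = (K + 2) * Δ ^ 2 * (T * Real.log (1 / δ)) / σ ^ 2 := by field_simp
        _ ≤ ε ^ 2 := by
          rw [div_le_iff₀ (by positivity)]
          linarith)
  refine ⟨hprob, fun G G' hG S hS => ?_⟩
  have h1 := (holderBound_noisyMirrorDescent lam tau η hpq (by exact_mod_cast hσ0.ne') W₀ _ _
    (hΔ G G' hG) T).map (measurable_logNorm_toMatrix N)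
  have h2 := h1.bind hpq.symm.pos train.measurable train.measurable
    fun y => HolderBound.refl hpq (train y)
  rw [mul_one] at h2
  refine h2.le_exp_mul_add hpq hδ (le_of_eq_of_le ?_ hp) hS
  ring

end Privacy

end MotifDP

namespace MotifDP

/-! ### Sensitivity of the clipped graph -/

section Clipping

/-! ### Ranks and stability of the top lists -/

variable {N d D : ℕ} {wmax : ℝ} {x : Fin N → EuclideanSpace ℝ (Fin d)}

theorem Precedes.trans {i j k l : Fin N} (h : Precedes x i j k) (h' : Precedes x i k l) :
    Precedes x i j l := by
  unfold Precedes at *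
  grind

theorem not_precedes_self (i j : Fin N) : ¬ Precedes x i j j := by
  simp [Precedes]

theorem precedes_or_precedes {i j k : Fin N} (h : j ≠ k) :
    Precedes x i j k ∨ Precedes x i k j := by
  unfold Precedes
  grind

open Classical in
/-- The number of elements of `s` that node `i` ranks strictly before `j`. -/
noncomputable def rank (x : Fin N → EuclideanSpace ℝ (Fin d)) (i : Fin N) (s : Finset (Fin N))
    (j : Fin N) : ℕ :=
  (s.filter fun k => Precedes x i k j).card

theorem rank_lt_rank {i j k : Fin N} {s : Finset (Fin N)} (hj : j ∈ s) (h : Precedes x i j k) :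
    rank x i s j < rank x i s k := by
  classical
  refine Finset.card_lt_card (Finset.ssubset_iff_of_subset ?_ |>.2 ⟨j, ?_, ?_⟩)
  · intro l hl
    rw [Finset.mem_filter] at hl ⊢
    exact ⟨hl.1, hl.2.trans h⟩
  · simp [hj, h]
  · simp [not_precedes_self]

theorem rank_injOn (i : Fin N) (s : Finset (Fin N)) : Set.InjOn (rank x i s) s := by
  intro j hj k hk h
  by_contra hne
  rcases precedes_or_precedes (x := x) (i := i) hne with h' | h'
  · exact (rank_lt_rank hj h').ne h
  · exact (rank_lt_rank hk h').ne' h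

theorem rank_le_rank_add_one {i b : Fin N} {s s' : Finset (Fin N)} (h : s' ⊆ insert b s)
    (j : Fin N) : rank x i s' j ≤ rank x i s j + 1 := by
  classical
  refine (Finset.card_le_card (t := insert b (s.filter fun k => Precedes x i k j)) ?_).trans
    (Finset.card_insert_le _ _)
  intro k hk
  have := h (Finset.mem_of_mem_filter k hk)
  simp only [Finset.mem_filter, Finset.mem_insert] at *
  tauto

open Classical in
/-- The neighbours of node `i`. -/
noncomputable def neighbors (G : InteractionGraph N wmax) (i : Fin N) : Finset (Fin N) :=
  Finset.univ.filter fun j => G.weight i j ≠ 0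

theorem mem_topNeighbors {G : InteractionGraph N wmax} {i j : Fin N} :
    j ∈ topNeighbors x D G i ↔ j ∈ neighbors G i ∧ rank x i (neighbors G i) j < D := by
  simp [topNeighbors, neighbors, rank, Finset.filter_filter]

theorem card_topNeighbors_le (G : InteractionGraph N wmax) (i : Fin N) :
    (topNeighbors x D G i).card ≤ D := by
  rw [← Finset.card_range D]
  refine Finset.card_le_card_of_injOn (rank x i (neighbors G i)) (fun j hj => ?_)
    ((rank_injOn i (neighbors G i)).mono fun j hj => (mem_topNeighbors.1 hj).1)
  simpa using (mem_topNeighbors.1 hj).2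

theorem topNeighbors_congr {G G' : InteractionGraph N wmax} {i : Fin N}
    (h : ∀ j, G.weight i j = G'.weight i j) : topNeighbors x D G i = topNeighbors x D G' i := by
  have hn : neighbors G i = neighbors G' i := by simp [neighbors, h]
  ext j
  rw [mem_topNeighbors, mem_topNeighbors, hn]

-- A node other than `b` that leaves the list had rank below `D` and now has rank at least `D`.
-- Since ranks grow by at most one, its old rank was exactly `D - 1`, and ranks are injective on the
-- neighbours.
open Classical in
theorem card_topNeighbors_sdiff_le {G G' : InteractionGraph N wmax} {i b : Fin N}
    (h : ∀ j ≠ b, G.weight i j = G'.weight i j) :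
    ((topNeighbors x D G i \ topNeighbors x D G' i).erase b).card ≤ 1 := by
  have hsub : neighbors G' i ⊆ insert b (neighbors G i) := by
    intro j hj
    by_cases hb : j = b
    · simp [hb]
    · simpa [neighbors, hb, h j hb] using hj
  have key : ∀ j ∈ (topNeighbors x D G i \ topNeighbors x D G' i).erase b,
      j ∈ neighbors G i ∧ rank x i (neighbors G i) j + 1 = D := by
    intro j hj
    rw [Finset.mem_erase, Finset.mem_sdiff, mem_topNeighbors, mem_topNeighbors] at hj
    obtain ⟨hb, ⟨hj, hr⟩, hn⟩ := hj
    have hj' : j ∈ neighbors G' i := by simpa [neighbors, h j hb] using hj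
    have := rank_le_rank_add_one (x := x) (i := i) hsub j
    have := not_lt.1 fun h => hn ⟨hj', h⟩
    exact ⟨hj, by omega⟩
  rw [Finset.card_le_one]
  intro j hj k hk
  refine rank_injOn (x := x) i (neighbors G i) (key j hj).1 (key k hk).1 ?_
  have := (key j hj).2
  have := (key k hk).2
  omega

theorem InteractionGraph.weight_max_nonneg (G : InteractionGraph N wmax) (i : Fin N) : 0 ≤ wmax :=
  (G.nonneg i i).trans (G.le_max i i)

theorem InteractionGraph.abs_sub_le (A A' : InteractionGraph N wmax) (i j : Fin N) :
    |A.weight i j - A'.weight i j| ≤ wmax :=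
  abs_sub_le_of_nonneg_of_le (A.nonneg i j) (A.le_max i j) (A'.nonneg i j) (A'.le_max i j)

theorem sum_clip_weight_le (G : InteractionGraph N wmax) (i : Fin N) :
    ∑ j, (clip x D G).weight i j ≤ D * wmax := by
  classical
  calc ∑ j, (clip x D G).weight i j
      ≤ ∑ j, if j ∈ topNeighbors x D G i then wmax else 0 := by
        refine Finset.sum_le_sum fun j _ => ?_
        split_ifs with h
        · exact (clip x D G).le_max i j
        · simp [clip, h]
    _ = (topNeighbors x D G i).card * wmax := by simp
    _ ≤ D * wmax := by
        have := G.weight_max_nonneg i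
        gcongr
        exact card_topNeighbors_le G i

/-- Changing the edge `{a, b}` changes at most three entries of the row `a` of the clipped
graph. -/
theorem sum_abs_clip_sub_row_le {G G' : InteractionGraph N wmax} {a b : Fin N}
    (h : ∀ i j : Fin N, s(i, j) ≠ s(a, b) → G.weight i j = G'.weight i j) :
    ∑ j, |(clip x D G).weight a j - (clip x D G').weight a j| ≤ 3 * wmax := by
  classical
  -- The entries that may change: `b` itself, at most one node lost and at most one gained.
  set E : Finset (Fin N) := insert b
    ((topNeighbors x D G a \ topNeighbors x D G' a).erase b ∪
      (topNeighbors x D G' a \ topNeighbors x D G a).erase b) with hE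
  have hrow : ∀ j ≠ b, G.weight a j = G'.weight a j := by
    intro j hj
    refine h a j fun hs => hj ?_
    rcases Sym2.eq_iff.1 hs with h | h
    · exact h.2
    · exact h.2.trans h.1
  have hcard : E.card ≤ 3 := by
    refine (Finset.card_insert_le _ _).trans ?_
    have h1 := card_topNeighbors_sdiff_le (x := x) (D := D) hrow
    have h2 := card_topNeighbors_sdiff_le (x := x) (D := D) fun j hj => (hrow j hj).symm
    have h3 := Finset.card_union_le ((topNeighbors x D G a \ topNeighbors x D G' a).erase b)
      ((topNeighbors x D G' a \ topNeighbors x D G a).erase b)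
    omega
  have hzero : ∀ j ∉ E, (clip x D G).weight a j = (clip x D G').weight a j := by
    intro j hj
    have hjb : j ≠ b := by grind
    have htop : j ∈ topNeighbors x D G a ↔ j ∈ topNeighbors x D G' a := by grind
    rcases eq_or_ne j a with rfl | hja
    · rw [InteractionGraph.loopless, InteractionGraph.loopless]
    -- For `j` outside `{a, b}` the whole row of `j` is unchanged, so whether `j` selects `a` is
    -- unchanged too.
    · have : topNeighbors x D G j = topNeighbors x D G' j := by
        refine topNeighbors_congr fun k => h j k fun hs => ?_
        rcases Sym2.eq_iff.1 hs with h | h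
        · exact hja h.1
        · exact hjb h.1
      simp only [clip, htop, this, hrow j hjb]
  have hw := G.weight_max_nonneg a
  calc ∑ j, |(clip x D G).weight a j - (clip x D G').weight a j|
      = ∑ j ∈ E, |(clip x D G).weight a j - (clip x D G').weight a j| := by
        refine (Finset.sum_subset (Finset.subset_univ E) fun j _ hj => ?_).symm
        rw [hzero j hj, sub_self, abs_zero]
    _ ≤ ∑ j ∈ E, wmax := Finset.sum_le_sum fun j _ => InteractionGraph.abs_sub_le _ _ _ _
    _ = E.card * wmax := by simp
    _ ≤ 3 * wmax := by
        gcongr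
        exact_mod_cast hcard

/-- The `L¹`-sensitivity of degree clipping. -/
theorem sum_abs_clip_sub_le {G G' : InteractionGraph N wmax} (h : EdgeNeighbor G G') :
    ∑ i, ∑ j, |(clip x D G).weight i j - (clip x D G').weight i j| ≤ 12 * wmax := by
  classical
  obtain ⟨a, b, h⟩ := h
  have ha := sum_abs_clip_sub_row_le (x := x) (D := D) h
  have hb := sum_abs_clip_sub_row_le (x := x) (D := D) (a := b) (b := a)
    (by simpa only [Sym2.eq_swap (a := b)] using h)
  set f : Fin N → Fin N → ℝ :=
    fun i j => |(clip x D G).weight i j - (clip x D G').weight i j| with hf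
  have hsymm : ∀ i j, f i j = f j i := fun i j => by
    simp only [hf, (clip x D G).symm i j, (clip x D G').symm i j]
  have hnn : ∀ i j, 0 ≤ f i j := fun i j => abs_nonneg _
  -- Changes are confined to the rows and columns of `a` and `b`: four lines costing at most `3 *
  -- wmax` each, hence `12 * wmax`.
  have hle : ∀ i j, f i j ≤ (if i = a then f a j else 0) + (if i = b then f b j else 0) +
      (if j = a then f a i else 0) + (if j = b then f b i else 0) := by
    intro i j
    have h1 : 0 ≤ if i = a then f a j else 0 := by split_ifs; exacts [hnn a j, le_rfl]
    have h2 : 0 ≤ if i = b then f b j else 0 := by split_ifs; exacts [hnn b j, le_rfl]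
    have h3 : 0 ≤ if j = a then f a i else 0 := by split_ifs; exacts [hnn a i, le_rfl]
    have h4 : 0 ≤ if j = b then f b i else 0 := by split_ifs; exacts [hnn b i, le_rfl]
    by_cases hij : i = a ∨ i = b ∨ j = a ∨ j = b
    · rcases hij with hi | hi | hj | hj
      · have : f i j = f a j := by rw [hi]
        rw [if_pos hi]
        linarith
      · have : f i j = f b j := by rw [hi]
        rw [if_pos hi]
        linarith
      · have : f i j = f a i := by rw [hsymm, hj]
        rw [if_pos hj]
        linarith
      · have : f i j = f b i := by rw [hsymm, hj]
        rw [if_pos hj]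
        linarith
    · push Not at hij
      obtain ⟨hia, hib, hja, hjb⟩ := hij
      have e1 : topNeighbors x D G i = topNeighbors x D G' i :=
        topNeighbors_congr fun k => h i k fun hs => by
          rcases Sym2.eq_iff.1 hs with h | h
          exacts [hia h.1, hib h.1]
      have e2 : topNeighbors x D G j = topNeighbors x D G' j :=
        topNeighbors_congr fun k => h j k fun hs => by
          rcases Sym2.eq_iff.1 hs with h | h
          exacts [hja h.1, hjb h.1]
      have e3 : G.weight i j = G'.weight i j := h i j fun hs => by
        rcases Sym2.eq_iff.1 hs with h | h
        exacts [hia h.1, hib h.1]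
      simp [hf, clip, e1, e2, e3, hia, hib, hja, hjb]
  calc ∑ i, ∑ j, f i j ≤ ∑ i, ∑ j, ((if i = a then f a j else 0) + (if i = b then f b j else 0) +
      (if j = a then f a i else 0) + (if j = b then f b i else 0)) :=
        Finset.sum_le_sum fun i _ => Finset.sum_le_sum fun j _ => hle i j
    _ = ∑ j, f a j + ∑ j, f b j + ∑ i, f a i + ∑ i, f b i := by
        simp only [Finset.sum_add_distrib]
        congr 1
        · congr 1
          · congr 1 <;> rw [Finset.sum_comm] <;> simp
          · simp
        · simp
    _ ≤ 12 * wmax := by linarith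

/-- Puts the edge regularizer's contribution in the form linear in `D`; for `D = 0` both clipped
graphs are empty. -/
theorem sum_abs_clip_sub_le_mul {G G' : InteractionGraph N wmax} (h : EdgeNeighbor G G') :
    ∑ i, ∑ j, |(clip x D G).weight i j - (clip x D G').weight i j| ≤ 12 * D * wmax := by
  obtain ⟨a, -, -⟩ := id h
  have hw := G.weight_max_nonneg a
  rcases Nat.eq_zero_or_pos D with rfl | hD
  · simp [clip, topNeighbors]
  · have : (1 : ℝ) ≤ D := by exact_mod_cast hD
    refine (sum_abs_clip_sub_le h).trans ?_
    nlinarith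

end Clipping

/-! ### Sensitivity of the triangle counts and of the gradient -/

theorem sum_pair_le {N : ℕ} (f : Fin N → Fin N → ℝ) (hf : ∀ i j, 0 ≤ f i j) :
    ∑ p : Pair N, f p.1.1 p.1.2 ≤ ∑ i, ∑ j, f i j := by
  classical
  rw [← Fintype.sum_prod_type' f,
    ← Finset.sum_subtype (Finset.univ.filter fun p : Fin N × Fin N => p.1 < p.2) (by simp)
      fun p => f p.1 p.2]
  exact Finset.sum_le_univ_sum_of_nonneg fun p => hf _ _

section Gradient

variable {N D : ℕ} {wmax : ℝ}

/-- The product of three weights telescopes. In each term one undifferenced factor is bounded by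
`wmax`; the other is kept so that it joins the differing edge to the third vertex, making its sum
over that vertex a row sum. -/
theorem abs_triangleCount_sub_le (A A' : InteractionGraph N wmax) (p : Pair N) :
    |triangleCount A p - triangleCount A' p| ≤ wmax * ∑ k,
      (|A.weight p.1.1 p.1.2 - A'.weight p.1.1 p.1.2| * A.weight p.1.1 k +
        |A.weight p.1.1 k - A'.weight p.1.1 k| * A.weight k p.1.2 +
        |A.weight p.1.2 k - A'.weight p.1.2 k| * A'.weight p.1.2 p.1.1) := by
  rw [triangleCount, triangleCount, ← Finset.sum_sub_distrib, Finset.mul_sum]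
  refine (Finset.abs_sum_le_sum_abs _ _).trans (Finset.sum_le_sum fun k _ => ?_)
  generalize p.1.1 = i
  generalize p.1.2 = j
  rw [A.symm k j, A'.symm j i]
  have key : A.weight i j * A.weight i k * A.weight j k -
      A'.weight i j * A'.weight i k * A'.weight j k =
      (A.weight i j - A'.weight i j) * A.weight i k * A.weight j k +
      (A.weight i k - A'.weight i k) * A.weight j k * A'.weight i j +
      (A.weight j k - A'.weight j k) * A'.weight i j * A'.weight i k := by ring
  rw [key]
  refine (abs_add_three _ _ _).trans ?_
  simp only [abs_mul, abs_of_nonneg (A.nonneg _ _), abs_of_nonneg (A'.nonneg _ _)]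
  rw [mul_add, mul_add, mul_comm wmax, mul_comm wmax, mul_comm wmax]
  have := A.nonneg i k
  have := A.nonneg j k
  have := A'.nonneg i j
  gcongr
  exacts [A.le_max _ _, A'.le_max _ _, A'.le_max _ _]

/-- Each of the three telescoped terms is summed first over the vertex not on the differing edge,
yielding a row sum at most `R`, and then over that edge. -/
theorem sum_abs_triangleCount_sub_le {A A' : InteractionGraph N wmax} {R : ℝ} (hw : 0 ≤ wmax)
    (hA : ∀ i, ∑ j, A.weight i j ≤ R) (hA' : ∀ i, ∑ j, A'.weight i j ≤ R) :
    ∑ p, |triangleCount A p - triangleCount A' p| ≤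
      3 * R * wmax * ∑ i, ∑ j, |A.weight i j - A'.weight i j| := by
  refine (Finset.sum_le_sum fun p _ => abs_triangleCount_sub_le A A' p).trans ?_
  refine (sum_pair_le (fun i j => wmax * ∑ k, (|A.weight i j - A'.weight i j| * A.weight i k +
        |A.weight i k - A'.weight i k| * A.weight k j +
        |A.weight j k - A'.weight j k| * A'.weight j i)) fun i j => ?_).trans ?_
  · refine mul_nonneg hw (Finset.sum_nonneg fun k _ => ?_)
    have := A.nonneg i k
    have := A.nonneg k j
    have := A'.nonneg j i
    positivity
  · simp only [← Finset.mul_sum, Finset.sum_add_distrib]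
    set S := ∑ i, ∑ j, |A.weight i j - A'.weight i j| with hS
    have h1 : ∑ i, ∑ j, |A.weight i j - A'.weight i j| * ∑ k, A.weight i k ≤ R * S := by
      rw [mul_comm, hS, Finset.sum_mul]
      refine Finset.sum_le_sum fun i _ => ?_
      rw [Finset.sum_mul]
      exact Finset.sum_le_sum fun j _ => mul_le_mul_of_nonneg_left (hA i) (abs_nonneg _)
    have h2 : ∑ i, ∑ j, ∑ k, |A.weight i k - A'.weight i k| * A.weight k j ≤ R * S := by
      rw [mul_comm, hS, Finset.sum_mul]
      refine Finset.sum_le_sum fun i _ => ?_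
      rw [Finset.sum_comm, Finset.sum_mul]
      refine Finset.sum_le_sum fun k _ => ?_
      rw [← Finset.mul_sum]
      exact mul_le_mul_of_nonneg_left (hA k) (abs_nonneg _)
    have h3 : ∑ i, ∑ j, ∑ k, |A.weight j k - A'.weight j k| * A'.weight j i ≤ R * S := by
      rw [mul_comm, hS, Finset.sum_mul, Finset.sum_comm]
      refine Finset.sum_le_sum fun j _ => ?_
      rw [Finset.sum_comm, Finset.sum_mul]
      refine Finset.sum_le_sum fun k _ => ?_
      rw [← Finset.mul_sum]
      exact mul_le_mul_of_nonneg_left (hA' j) (abs_nonneg _)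
    calc _ ≤ wmax * (R * S + R * S + R * S) := by gcongr
      _ = _ := by ring

theorem norm_toLp_le_sum_abs {ι : Type*} [Fintype ι] (v : ι → ℝ) :
    ‖WithLp.toLp 2 v‖ ≤ ∑ i, |v i| := by
  rw [EuclideanSpace.norm_eq]
  refine Real.sqrt_le_iff.2 ⟨by positivity, ?_⟩
  simpa using Finset.sum_sq_le_sq_sum_of_nonneg (s := Finset.univ) fun i _ => abs_nonneg (v i)

/-- The `L²`-sensitivity of the motif gradient on clipped graphs. -/
theorem norm_motifGrad_sub_le {d : ℕ} {lam : ℝ} (hlam : 0 ≤ lam) (hw : 0 < wmax)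
    (hw1 : wmax ≤ 1) (x : Fin N → EuclideanSpace ℝ (Fin d)) (tau : ℝ)
    {G G' : InteractionGraph N wmax} (h : EdgeNeighbor G G') (W : Weights N) :
    ‖WithLp.toLp 2 (motifGrad lam tau (clip x D G) W - motifGrad lam tau (clip x D G') W)‖ ≤
      (36 + 24 * lam) * D * wmax := by
  set A := clip x D G
  set A' := clip x D G'
  refine (norm_toLp_le_sum_abs _).trans ?_
  have hS : ∑ i, ∑ j, |A.weight i j - A'.weight i j| ≤ 12 * wmax := sum_abs_clip_sub_le h
  have hSD : ∑ i, ∑ j, |A.weight i j - A'.weight i j| ≤ 12 * D * wmax :=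
    sum_abs_clip_sub_le_mul h
  have hM := sum_abs_triangleCount_sub_le hw.le (sum_clip_weight_le (x := x) (D := D) G)
    (sum_clip_weight_le (x := x) (D := D) G')
  have hE := sum_pair_le (fun i j => |A.weight i j - A'.weight i j|) fun _ _ => abs_nonneg _
  calc ∑ p, |(motifGrad lam tau A W - motifGrad lam tau A' W) p|
      ≤ ∑ p : Pair N, (|triangleCount A p - triangleCount A' p| +
          2 * lam * |A.weight p.1.1 p.1.2 - A'.weight p.1.1 p.1.2|) := by
        refine Finset.sum_le_sum fun p _ => ?_
        have : (motifGrad lam tau A W - motifGrad lam tau A' W) p =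
            -(triangleCount A p - triangleCount A' p) +
              -(2 * lam * (A.weight p.1.1 p.1.2 - A'.weight p.1.1 p.1.2)) := by
          simp only [motifGrad, Pi.sub_apply]
          ring
        rw [this]
        refine (abs_add_le _ _).trans_eq ?_
        rw [abs_neg, abs_neg, abs_mul, abs_of_nonneg (by positivity : 0 ≤ 2 * lam)]
    _ = ∑ p, |triangleCount A p - triangleCount A' p| +
          2 * lam * ∑ p : Pair N, |A.weight p.1.1 p.1.2 - A'.weight p.1.1 p.1.2| := by
        rw [Finset.sum_add_distrib, Finset.mul_sum]
    -- The triangle part uses the bound `12 * wmax` without `D`, since the row sums already supply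
    -- one factor `D`. The constants are `36 = 3 * 12` and `24 = 2 * 12`.
    _ ≤ 3 * (D * wmax) * wmax * (12 * wmax) + 2 * lam * (12 * D * wmax) := by
        gcongr
        · exact hM.trans (by gcongr)
        · exact hE.trans hSD
    _ ≤ (36 + 24 * lam) * D * wmax := by
        have h2 : wmax * wmax ≤ 1 := by nlinarith
        have h3 : (D * wmax) * (wmax * wmax) ≤ (D * wmax) * 1 := by gcongr
        linarith

end Gradient

end MotifDP

theorem theorem1 (lam : ℝ) (hlam : 0 ≤ lam) :
    ∃ C : ℝ, 0 < C ∧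
      -- the L2-sensitivity of the motif gradient is at most `Δ₂ = C * Dmax * wmax`
      (∀ (N d Dmax : ℕ) (wmax : ℝ), 0 < wmax → wmax ≤ 1 →
        ∀ (x : Fin N → EuclideanSpace ℝ (Fin d)) (tau : ℝ), 0 ≤ tau →
        ∀ G G' : MotifDP.InteractionGraph N wmax, MotifDP.EdgeNeighbor G G' →
        ∀ W : MotifDP.Weights N, (∀ p, 0 < W p) →
          ‖WithLp.toLp 2 (MotifDP.motifGrad lam tau (MotifDP.clip x Dmax G) W
            - MotifDP.motifGrad lam tau (MotifDP.clip x Dmax G') W)‖ ≤ C * Dmax * wmax) ∧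
      -- privacy with noise of scale `c * Δ₂ * √(T * ln (1/δ)) / ε`
      ∀ K : ℝ, 0 < K → ∃ c : ℝ, 0 < c ∧
        ∀ (N d Dmax T : ℕ) (wmax : ℝ), 0 < wmax → wmax ≤ 1 →
        ∀ (x : Fin N → EuclideanSpace ℝ (Fin d)) (tau η : ℝ), 0 ≤ tau → 0 < η →
        ∀ W₀ : MotifDP.Weights N, (∀ p, 0 < W₀ p) →
        ∀ (ε δ : ℝ) (σ : NNReal), 0 < ε → 0 < δ → δ < 1 → ε ≤ K * Real.log (1 / δ) →
          c * (C * Dmax * wmax) * Real.sqrt (T * Real.log (1 / δ)) / ε ≤ (σ : ℝ) →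
          MotifDP.IsEdgeDP (fun G : MotifDP.InteractionGraph N wmax =>
              MotifDP.graphSynthesis x Dmax lam tau η σ W₀ T G) ε δ ∧
          -- any randomized training procedure that uses only the released graph and public data
          ∀ (Θ : Type*) [MeasurableSpace Θ]
            (train : ProbabilityTheory.Kernel (Fin N → Fin N → ℝ) Θ)
            [ProbabilityTheory.IsMarkovKernel train],
            MotifDP.IsEdgeDP (fun G : MotifDP.InteractionGraph N wmax =>
              (MotifDP.graphSynthesis x Dmax lam tau η σ W₀ T G).bind train) ε δ := by
  refine ⟨36 + 24 * lam, by positivity, fun N d Dmax wmax hw hw1 x tau _ G G' hG W _ =>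
    MotifDP.norm_motifGrad_sub_le hlam hw hw1 x tau hG W, fun K hK => ⟨K + 2, by positivity, ?_⟩⟩
  intro N d Dmax T wmax hw hw1 x tau η _ _ W₀ _ ε δ σ hε hδ hδ1 hεK hσ
  have key : ∀ (Θ : Type _) [MeasurableSpace Θ]
      (train : ProbabilityTheory.Kernel (Fin N → Fin N → ℝ) Θ)
      [ProbabilityTheory.IsMarkovKernel train],
      MotifDP.IsEdgeDP (fun G : MotifDP.InteractionGraph N wmax =>
        (MotifDP.graphSynthesis x Dmax lam tau η σ W₀ T G).bind train) ε δ :=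
    fun Θ _ train _ => MotifDP.isEdgeDP_graphSynthesis_bind x Dmax lam tau η hK hε hδ hδ1 hεK σ T
      (by positivity) hσ (fun G G' hG W => MotifDP.norm_motifGrad_sub_le hlam hw hw1 x tau hG W)
      W₀ train
  refine ⟨?_, key⟩
  -- The release itself is the post-processing by the identity kernel.
  have hid := MotifDP.isEdgeDP_graphSynthesis_bind x Dmax lam tau η hK hε hδ hδ1 hεK σ T
    (by positivity) hσ (fun G G' hG W => MotifDP.norm_motifGrad_sub_le hlam hw hw1 x tau hG W)
    W₀ ProbabilityTheory.Kernel.id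
  simpa only [MeasureTheory.Measure.id_comp] using hid
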